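/- Let $\lambda=(\lambda_1,\dots,\lambda_n)\in\mathbb C^n$, and let $F=(F_1,\dots,F_n)\in\mathbb C[[x_1,\dots,x_n]]^n$ be a formal vector field with $F(0)=0$ and $DF(0)=\mathrm{diag}(\lambda_1,\dots,\lambda_n)$. Let $\mathbf N\subset\mathbb Z^n$ be the set of all $Q=(q_1,\dots,q_n)$ such that, for some $i$, $q_i\ge -1$ and $q_j\ge 0$ for all $j\ne i$. Write $\lambda\odot x=(\lambda_1x_1,\dots,\lambda_nx_n)$ for the entrywise product, $x^Q=x_1^{q_1}\cdots x_n^{q_n}$, and $$F(x)=\sum_{Q\in\mathbf N}(x\odot F_Q)\,x^Q,\qquad F_Q\in\mathbb C^n,$$ where the $i$-th entry of $F_Q$ is the coefficient of $x_i x^Q$ in $F_i$ (and is $0$ if $x_ix^Q$ has a negative exponent). Assume that $F$ is in Poincaré–Dulac normal form, i.e. $F_Q=0$ for every $Q\in\mathbf N$ with $\langle Q,\lambda\rangle=\sum_i q_i\lambda_i\ne 0$. Elements of the field of fractions $\mathbb C((x_1,\dots,x_n))$ of $\mathbb C[[x_1,\dots,x_n]]$ are called formally meromorphic functions. A formally meromorphic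 first integral of a formal vector field $\dot x=G(x)$ is a nonconstant $f\in\mathbb C((x_1,\dots,x_n))$ with $L_G(f)=\sum_{i=1}^n G_i\,\partial f/\partial x_i=0$. Then every formally meromorphic first integral of $\dot x=F(x)$ is also a first integral of the linear vector field $\dot x=\lambda\odot x$. Moreover, if $\dot x=F(x)$ admits a formally meromorphic first integral, then $\dot x=\lambda\odot x$ admits a Laurent monomial first integral, i.e. there is $Q\in\mathbb Z^n$ such that $x^Q$ is a nonconstant first integral of $\dot x=\lambda\odot x$. -/

import Mathlib

noncomputable section

namespace FormalVF

/-! ### Extending a derivation of a domain to its field of fractions -/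

section FractionDerivation

variable {k R : Type*} [CommRing k] [CommRing R] [IsDomain R] [Algebra k R]

/-- The quotient rule `v / w ↦ (w * D v - v * D w) / w ^ 2`, read off from one chosen representation
of an element of the field of fractions as a quotient `v / w`. -/
def fracDerivFun (D : Derivation k R R) (f : FractionRing R) : FractionRing R :=
  let v : R := (IsLocalization.sec (nonZeroDivisors R) f).1
  let w : R := (IsLocalization.sec (nonZeroDivisors R) f).2
  algebraMap R (FractionRing R) (w * D v - v * D w) / algebraMap R (FractionRing R) w ^ 2

/-- The quotient rule holds for every representation as a quotient. -/
theorem fracDerivFun_div (D : Derivation k R R) (v w : R) (hw : w ≠ 0) :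
    fracDerivFun D (algebraMap R (FractionRing R) v / algebraMap R (FractionRing R) w) =
      algebraMap R (FractionRing R) (w * D v - v * D w) /
        algebraMap R (FractionRing R) w ^ 2 := by
  set f := algebraMap R (FractionRing R) v / algebraMap R (FractionRing R) w with hf
  have hinj : Function.Injective (algebraMap R (FractionRing R)) :=
    IsFractionRing.injective R (FractionRing R)
  have hw' : algebraMap R (FractionRing R) w ≠ 0 := by
    simpa using (map_ne_zero_iff _ hinj).2 hw
  unfold fracDerivFun
  have hs := IsLocalization.sec_spec (nonZeroDivisors R) f
  have hb0 : ((IsLocalization.sec (nonZeroDivisors R) f).2 : R) ≠ 0 :=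
    nonZeroDivisors.coe_ne_zero _
  generalize (IsLocalization.sec (nonZeroDivisors R) f).1 = a at *
  generalize ((IsLocalization.sec (nonZeroDivisors R) f).2 : R) = b at *
  have hb' : algebraMap R (FractionRing R) b ≠ 0 := (map_ne_zero_iff _ hinj).2 hb0
  have hcross : v * b = a * w := by
    apply hinj
    rw [map_mul, map_mul, ← hs, hf]
    field_simp
  have hD : v * D b + b * D v = a * D w + w * D a := by
    have := congrArg D hcross
    simpa using this
  rw [div_eq_div_iff (pow_ne_zero 2 hb') (pow_ne_zero 2 hw')]
  rw [← map_pow, ← map_pow, ← map_mul, ← map_mul]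
  congr 1
  linear_combination (-(b * w)) * hD + (w * D b + b * D w) * hcross

/-- The extension of a derivation of a domain to its field of fractions. -/
def fracDeriv (D : Derivation k R R) : Derivation k (FractionRing R) (FractionRing R) :=
  have hinj : Function.Injective (algebraMap R (FractionRing R)) :=
    IsFractionRing.injective R (FractionRing R)
  Derivation.mk'
    { toFun := fracDerivFun D
      map_add' := by
        intro f g
        obtain ⟨a, b, hb, rfl⟩ := IsFractionRing.div_surjective (A := R) f
        obtain ⟨c, d, hd, rfl⟩ := IsFractionRing.div_surjective (A := R) g
        have hb0 := nonZeroDivisors.ne_zero hb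
        have hd0 := nonZeroDivisors.ne_zero hd
        have hb' : algebraMap R (FractionRing R) b ≠ 0 := (map_ne_zero_iff _ hinj).2 hb0
        have hd' : algebraMap R (FractionRing R) d ≠ 0 := (map_ne_zero_iff _ hinj).2 hd0
        have hsum : algebraMap R (FractionRing R) a / algebraMap R (FractionRing R) b +
            algebraMap R (FractionRing R) c / algebraMap R (FractionRing R) d =
            algebraMap R (FractionRing R) (a * d + b * c) /
              algebraMap R (FractionRing R) (b * d) := by
          rw [div_add_div _ _ hb' hd']; simp
        rw [hsum, fracDerivFun_div D _ _ (mul_ne_zero hb0 hd0), fracDerivFun_div D _ _ hb0,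
          fracDerivFun_div D _ _ hd0]
        simp only [map_add, map_sub, map_mul, Derivation.leibniz, smul_eq_mul]
        field_simp
        ring
      map_smul' := by
        intro r f
        obtain ⟨a, b, hb, rfl⟩ := IsFractionRing.div_surjective (A := R) f
        have hb0 := nonZeroDivisors.ne_zero hb
        have hr : r • (algebraMap R (FractionRing R) a / algebraMap R (FractionRing R) b) =
            algebraMap R (FractionRing R) (r • a) / algebraMap R (FractionRing R) b := by
          rw [Algebra.smul_def, Algebra.smul_def, map_mul,
            IsScalarTower.algebraMap_apply k R (FractionRing R), mul_div_assoc]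
        rw [hr, fracDerivFun_div D _ _ hb0, fracDerivFun_div D _ _ hb0, RingHom.id_apply,
          Algebra.smul_def r (_ / _), IsScalarTower.algebraMap_apply k R (FractionRing R),
          ← mul_div_assoc, ← map_mul]
        congr 2
        rw [Derivation.map_smul, Algebra.smul_def, Algebra.smul_def]
        ring }
    (by
      intro f g
      obtain ⟨a, b, hb, rfl⟩ := IsFractionRing.div_surjective (A := R) f
      obtain ⟨c, d, hd, rfl⟩ := IsFractionRing.div_surjective (A := R) g
      have hb0 := nonZeroDivisors.ne_zero hb
      have hd0 := nonZeroDivisors.ne_zero hd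
      have hb' : algebraMap R (FractionRing R) b ≠ 0 := (map_ne_zero_iff _ hinj).2 hb0
      have hd' : algebraMap R (FractionRing R) d ≠ 0 := (map_ne_zero_iff _ hinj).2 hd0
      have hprod : algebraMap R (FractionRing R) a / algebraMap R (FractionRing R) b *
          (algebraMap R (FractionRing R) c / algebraMap R (FractionRing R) d) =
          algebraMap R (FractionRing R) (a * c) / algebraMap R (FractionRing R) (b * d) := by
        rw [div_mul_div_comm]; simp
      change fracDerivFun D _ = _ • fracDerivFun D _ + _ • fracDerivFun D _
      rw [hprod, fracDerivFun_div D _ _ (mul_ne_zero hb0 hd0), fracDerivFun_div D _ _ hb0,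
        fracDerivFun_div D _ _ hd0]
      simp only [map_sub, map_mul, map_add, Derivation.leibniz, smul_eq_mul]
      field_simp
      ring)

theorem fracDeriv_div (D : Derivation k R R) (v w : R) (hw : w ≠ 0) :
    fracDeriv D (algebraMap R (FractionRing R) v / algebraMap R (FractionRing R) w) =
      algebraMap R (FractionRing R) (w * D v - v * D w) /
        algebraMap R (FractionRing R) w ^ 2 :=
  fracDerivFun_div D v w hw

theorem fracDeriv_algebraMap (D : Derivation k R R) (v : R) :
    fracDeriv D (algebraMap R (FractionRing R) v) = algebraMap R (FractionRing R) (D v) := by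
  have := fracDeriv_div D v 1 one_ne_zero
  simpa using this

end FractionDerivation

/-! ### Formal vector fields and formally meromorphic functions -/

instance instIsDomainMvPowerSeries (n : ℕ) : IsDomain (MvPowerSeries (Fin n) ℂ) := NoZeroDivisors.to_isDomain _

/-- Formal vector fields `ẋ = F x` on `ℂⁿ`: the component `F i` is a power series in `n` variables. -/
abbrev FormalVectorField (n : ℕ) : Type := Fin n → MvPowerSeries (Fin n) ℂ

/-- Formally meromorphic functions: quotients of formal power series in `n` variables. -/
abbrev FormalMeromorphic (n : ℕ) : Type := FractionRing (MvPowerSeries (Fin n) ℂ)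

variable {n : ℕ}

/-- The Lie derivative `L_F f = ∑ i, F i * ∂f/∂x_i` of a formally meromorphic function. -/
def lieDeriv (F : FormalVectorField n) (f : FormalMeromorphic n) : FormalMeromorphic n :=
  ∑ i, algebraMap (MvPowerSeries (Fin n) ℂ) (FormalMeromorphic n) (F i) *
    fracDeriv (MvPowerSeries.pderiv ℂ i) f

/-- A formally meromorphic first integral of `ẋ = F x`: a nonconstant formally meromorphic function
whose Lie derivative along `F` is zero. -/
def IsFirstIntegral (F : FormalVectorField n) (f : FormalMeromorphic n) : Prop :=
  (∀ c : ℂ, f ≠ algebraMap ℂ (FormalMeromorphic n) c) ∧ lieDeriv F f = 0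

/-- The linear vector field `ẋ = lam ⊙ x`. -/
def linearField (lam : Fin n → ℂ) : FormalVectorField n :=
  fun i => MvPowerSeries.C (lam i) * MvPowerSeries.X i

/-- The Laurent monomial `x ^ Q = ∏ i, x_i ^ (Q i)`, for integer exponents. -/
def laurentMonomial (Q : Fin n → ℤ) : FormalMeromorphic n :=
  ∏ i, algebraMap (MvPowerSeries (Fin n) ℂ) (FormalMeromorphic n) (MvPowerSeries.X i) ^ (Q i)

/-! ### Poincaré–Dulac normal form -/

/-- `F 0 = 0` and `DF 0 = diag(lam)`. -/
def HasDiagonalLinearPart (F : FormalVectorField n) (lam : Fin n → ℂ) : Prop :=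
  ∀ i, MvPowerSeries.constantCoeff (F i) = 0 ∧
    ∀ j, MvPowerSeries.coeff (Finsupp.single j 1) (F i) = if i = j then lam i else 0

/-- The set `N = N_1 ∪ … ∪ N_n` of degrees of the terms of a formal vector field, where `N_i`
consists of the integer vectors `Q` with `Q i ≥ -1` and `Q j ≥ 0` for `j ≠ i`. -/
def degrees (n : ℕ) : Set (Fin n → ℤ) :=
  {Q | ∃ i, -1 ≤ Q i ∧ ∀ j, j ≠ i → 0 ≤ Q j}

/-- The coefficient vector `F_Q` in `F = ∑_{Q ∈ N} (x ⊙ F_Q) x ^ Q`: its entry at `i` is the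
coefficient in `F i` of the monomial `x_i * x ^ Q`, and `0` when that has a negative exponent. -/
def degreeCoeff (F : FormalVectorField n) (Q : Fin n → ℤ) : Fin n → ℂ := fun i =>
  if ∀ j, 0 ≤ (Q + (Pi.single i 1 : Fin n → ℤ)) j then
    MvPowerSeries.coeff
      (Finsupp.equivFunOnFinite.symm fun j => ((Q + (Pi.single i 1 : Fin n → ℤ)) j).toNat) (F i)
  else 0

/-- Poincaré–Dulac normal form: `F_Q = 0` for every `Q ∈ N` with `⟨Q, lam⟩ ≠ 0`. -/
def IsNormalForm (F : FormalVectorField n) (lam : Fin n → ℂ) : Prop :=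
  ∀ Q ∈ degrees n, ∑ j, (Q j : ℂ) * lam j ≠ 0 → degreeCoeff F Q = 0

/-- In terms of monomials: `x ^ m` occurs in `F i` only if `⟨m, lam⟩ = lam i`. -/
theorem isNormalForm_iff (F : FormalVectorField n) (lam : Fin n → ℂ) :
    IsNormalForm F lam ↔ ∀ (i : Fin n) (m : Fin n →₀ ℕ),
      MvPowerSeries.coeff m (F i) ≠ 0 → ∑ j, (m j : ℂ) * lam j = lam i := by
  have hsum : ∀ (Q : Fin n → ℤ) (i : Fin n),
      ∑ j, (((Q + (Pi.single i 1 : Fin n → ℤ)) j : ℤ) : ℂ) * lam j = ∑ j, (Q j : ℂ) * lam j + lam i := by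
    intro Q i
    simp [add_mul, Finset.sum_add_distrib, Pi.single_apply]
  constructor
  · intro h i m hm
    by_contra hne
    set Q : Fin n → ℤ := fun j => (m j : ℤ) - (Pi.single i 1 : Fin n → ℤ) j with hQ
    have hQm : ∀ j, (Q + (Pi.single i 1 : Fin n → ℤ)) j = (m j : ℤ) := by intro j; simp [hQ]
    have hQN : Q ∈ degrees n := by
      refine ⟨i, ?_, fun j hj => ?_⟩
      · simp only [hQ, Pi.single_eq_same]
        omega
      · simp [hQ, hj]
    have hQl : ∑ j, (Q j : ℂ) * lam j ≠ 0 := by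
      intro h0
      have := hsum Q i
      simp only [hQm, h0, zero_add, Int.cast_natCast] at this
      exact hne this
    have h1 := congrFun (h Q hQN hQl) i
    apply hm
    unfold degreeCoeff at h1
    rw [if_pos (by intro j; rw [hQm]; positivity)] at h1
    have hmm : (Finsupp.equivFunOnFinite.symm fun j => ((Q + (Pi.single i 1 : Fin n → ℤ)) j).toNat) = m := by
      ext j
      simp [hQ]
    rw [hmm] at h1
    simpa using h1
  · intro h Q _ hQl
    funext i
    unfold degreeCoeff
    split_ifs with hpos
    · by_contra hne
      have h1 := h i _ hne
      have h2 := hsum Q i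
      apply hQl
      have h3 : ∀ j, ((((Q + (Pi.single i 1 : Fin n → ℤ)) j).toNat : ℕ) : ℂ)
          = (((Q + (Pi.single i 1 : Fin n → ℤ)) j : ℤ) : ℂ) := by
        intro j
        have := Int.toNat_of_nonneg (hpos j)
        exact_mod_cast congrArg (Int.cast : ℤ → ℂ) this
      simp only [Finsupp.equivFunOnFinite_symm_apply_apply, h3] at h1
      rw [h1] at h2
      linear_combination -h2
    · rfl

end FormalVF

end

/-!
Write `f = v / w` with power series `v`, `w`, and let `D` and `L` be the derivations of
`ℂ⟦x₁, …, xₙ⟧` given by `F` and by its linear part. Then `D f = 0` means `w * D v = v * D w`, and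
applying `D` repeatedly gives `w * p(D) v = v * p(D) w` for every polynomial `p`
(`mul_aeval_derivation_eq`).

The monomial `x ^ d` is an eigenvector of `L` for the weight `⟨d, lam⟩`. Normal form means that `D`
preserves the weight spaces, and on the one of weight `μ` the operator `D - μ = D - L` raises the
order. Hence on jets of any given order `L` is the semisimple part of `D`, and the Chinese remainder
theorem, applied to powers of the `X - μ` for the finitely many weights `μ` that occur, yields a
polynomial `p` such that `p(D)` and `L` agree on these jets
(`exists_aeval_fieldDerivation_sub_mem_orderIdeal`). So `w * L v = v * L w` modulo terms of
arbitrarily high degree, that is, `L f = 0`.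

For the Laurent monomial, compare lexicographically leading terms in `w * L v = v * L w`: the
leading monomials of `v` and `w` have the same weight. After subtracting from `v` a constant
multiple of `w` they are distinct, because `v / w` is not constant
(`exists_ne_monomialWeight_eq`), and their quotient is the required first integral.
-/

noncomputable section

namespace FormalVF

open MvPowerSeries (coeff lexOrder coeff_ne_zero_of_lexOrder coeff_eq_zero_of_lt_lexOrder
  exists_finsupp_eq_lexOrder_of_ne_zero)
open Finsupp (single)
open Polynomial (aeval)
open scoped Polynomial

variable {n : ℕ}

/-! ### Formal vector fields as derivations -/

/-- The derivation `f ↦ ∑ i, F i * ∂f/∂x_i` of the ring of formal power series. -/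
def fieldDerivation (F : FormalVectorField n) :
    Derivation ℂ (MvPowerSeries (Fin n) ℂ) (MvPowerSeries (Fin n) ℂ) :=
  ∑ i, F i • MvPowerSeries.pderiv ℂ i

theorem fieldDerivation_apply (F : FormalVectorField n) (f : MvPowerSeries (Fin n) ℂ) :
    fieldDerivation F f = ∑ i, F i * MvPowerSeries.pderiv ℂ i f := by
  rw [fieldDerivation, ← Derivation.coeFnAddMonoidHom_apply, map_sum, Finset.sum_apply]
  rfl

theorem lieDeriv_div (F : FormalVectorField n) (v w : MvPowerSeries (Fin n) ℂ) (hw : w ≠ 0) :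
    lieDeriv F (algebraMap _ (FormalMeromorphic n) v / algebraMap _ (FormalMeromorphic n) w) =
      algebraMap _ (FormalMeromorphic n) (w * fieldDerivation F v - v * fieldDerivation F w) /
        algebraMap _ (FormalMeromorphic n) w ^ 2 := by
  simp only [lieDeriv, fracDeriv_div _ _ _ hw, fieldDerivation_apply, ← mul_div_assoc]
  rw [← Finset.sum_div, Finset.mul_sum, Finset.mul_sum, ← Finset.sum_sub_distrib, map_sum]
  congr 1
  refine Finset.sum_congr rfl fun i _ => ?_
  rw [← map_mul]
  congr 1
  ring

/-- Clearing denominators in the equation `L_F (v / w) = 0`. -/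
theorem lieDeriv_div_eq_zero_iff (F : FormalVectorField n) (v w : MvPowerSeries (Fin n) ℂ)
    (hw : w ≠ 0) :
    lieDeriv F (algebraMap _ (FormalMeromorphic n) v / algebraMap _ (FormalMeromorphic n) w) = 0 ↔
      w * fieldDerivation F v = v * fieldDerivation F w := by
  have hinj : Function.Injective (algebraMap (MvPowerSeries (Fin n) ℂ) (FormalMeromorphic n)) :=
    IsFractionRing.injective _ _
  have hw' : algebraMap (MvPowerSeries (Fin n) ℂ) (FormalMeromorphic n) w ≠ 0 :=
    (map_ne_zero_iff _ hinj).2 hw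
  rw [lieDeriv_div F v w hw, div_eq_zero_iff, or_iff_left (pow_ne_zero 2 hw'),
    map_eq_zero_iff _ hinj, sub_eq_zero]

/-! ### Weights -/

/-- The weight `⟨d, lam⟩` of the monomial `x ^ d`. -/
def monomialWeight (lam : Fin n → ℂ) (d : Fin n →₀ ℕ) : ℂ := ∑ j, (d j : ℂ) * lam j

theorem monomialWeight_add (lam : Fin n → ℂ) (d e : Fin n →₀ ℕ) :
    monomialWeight lam (d + e) = monomialWeight lam d + monomialWeight lam e := by
  simp [monomialWeight, add_mul, Finset.sum_add_distrib]

theorem monomialWeight_single (lam : Fin n → ℂ) (i : Fin n) :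
    monomialWeight lam (single i 1) = lam i := by
  simp [monomialWeight, Finsupp.single_apply]

theorem coeff_X_mul_pderiv (i : Fin n) (f : MvPowerSeries (Fin n) ℂ) (d : Fin n →₀ ℕ) :
    coeff d (MvPowerSeries.X i * MvPowerSeries.pderiv ℂ i f) = d i * coeff d f := by
  rw [MvPowerSeries.X_def, MvPowerSeries.coeff_monomial_mul]
  split_ifs with h
  · have hi : 1 ≤ d i := by simpa using h i
    rw [MvPowerSeries.coeff_pderiv, tsub_add_cancel_of_le h, one_mul, mul_comm]
    simp [Finsupp.tsub_apply, Nat.cast_sub hi]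
  · have hi : d i = 0 := by
      by_contra h0
      exact h (Finsupp.single_le_iff.2 (Nat.one_le_iff_ne_zero.2 h0))
    simp [hi]

theorem coeff_fieldDerivation_linearField (lam : Fin n → ℂ) (f : MvPowerSeries (Fin n) ℂ)
    (d : Fin n →₀ ℕ) :
    coeff d (fieldDerivation (linearField lam) f) = monomialWeight lam d * coeff d f := by
  simp only [fieldDerivation_apply, linearField, map_sum, mul_assoc, MvPowerSeries.coeff_C_mul,
    coeff_X_mul_pderiv, monomialWeight, Finset.sum_mul]
  exact Finset.sum_congr rfl fun i _ => by ring

/-- The power series all of whose monomials have weight `μ`, which is the eigenspace of the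
linear vector field for the eigenvalue `μ`. -/
def weightSpace (lam : Fin n → ℂ) (μ : ℂ) : Submodule ℂ (MvPowerSeries (Fin n) ℂ) where
  carrier := {f | ∀ d, coeff d f ≠ 0 → monomialWeight lam d = μ}
  zero_mem' := by simp
  add_mem' := by
    intro f g hf hg d hd
    by_cases h : coeff d f = 0
    · exact hg d (by simpa [h] using hd)
    · exact hf d h
  smul_mem' := by
    intro c f hf d hd
    rw [MvPowerSeries.coeff_smul] at hd
    exact hf d (right_ne_zero_of_mul hd)

theorem mul_mem_weightSpace {lam : Fin n → ℂ} {μ ν : ℂ} {f g : MvPowerSeries (Fin n) ℂ}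
    (hf : f ∈ weightSpace lam μ) (hg : g ∈ weightSpace lam ν) :
    f * g ∈ weightSpace lam (μ + ν) := by
  intro d hd
  rw [MvPowerSeries.coeff_mul] at hd
  obtain ⟨⟨a, b⟩, hab, hne⟩ := Finset.exists_ne_zero_of_sum_ne_zero hd
  rw [← Finset.HasAntidiagonal.mem_antidiagonal.1 hab, monomialWeight_add,
    hf a (left_ne_zero_of_mul hne), hg b (right_ne_zero_of_mul hne)]

theorem pderiv_mem_weightSpace {lam : Fin n → ℂ} {μ : ℂ} {f : MvPowerSeries (Fin n) ℂ}
    (hf : f ∈ weightSpace lam μ) (i : Fin n) :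
    MvPowerSeries.pderiv ℂ i f ∈ weightSpace lam (μ - lam i) := by
  intro d hd
  rw [MvPowerSeries.coeff_pderiv] at hd
  rw [← hf _ (left_ne_zero_of_mul hd), monomialWeight_add, monomialWeight_single]
  ring

theorem fieldDerivation_linearField_of_mem_weightSpace {lam : Fin n → ℂ} {μ : ℂ}
    {f : MvPowerSeries (Fin n) ℂ} (hf : f ∈ weightSpace lam μ) :
    fieldDerivation (linearField lam) f = μ • f := by
  ext d
  rw [coeff_fieldDerivation_linearField, MvPowerSeries.coeff_smul]
  by_cases h : coeff d f = 0
  · simp [h]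
  · rw [hf d h]

/-- A vector field in Poincaré–Dulac normal form preserves weights, so it commutes with its
linear part. -/
theorem IsNormalForm.fieldDerivation_mem_weightSpace {F : FormalVectorField n} {lam : Fin n → ℂ}
    (hnf : IsNormalForm F lam) {μ : ℂ} {f : MvPowerSeries (Fin n) ℂ}
    (hf : f ∈ weightSpace lam μ) : fieldDerivation F f ∈ weightSpace lam μ := by
  rw [fieldDerivation_apply]
  refine Submodule.sum_mem _ fun i _ => ?_
  have hF : F i ∈ weightSpace lam (lam i) := (isNormalForm_iff F lam).1 hnf i
  simpa using mul_mem_weightSpace hF (pderiv_mem_weightSpace hf i)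

/-! ### The filtration by order -/

/-- The ideal of power series without terms of degree less than `k`. -/
def orderIdeal (n k : ℕ) : Ideal (MvPowerSeries (Fin n) ℂ) where
  carrier := {f | (k : ℕ∞) ≤ f.order}
  zero_mem' := by simp
  add_mem' := fun hf hg => (le_min hf hg).trans MvPowerSeries.min_order_le_add
  smul_mem' := fun _ _ hf => (hf.trans le_add_self).trans MvPowerSeries.le_order_mul

theorem mem_orderIdeal_iff {k : ℕ} {f : MvPowerSeries (Fin n) ℂ} :
    f ∈ orderIdeal n k ↔ ∀ d : Fin n →₀ ℕ, d.degree < k → coeff d f = 0 :=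
  ⟨fun hf _ hd => MvPowerSeries.coeff_of_lt_order ((Nat.cast_lt.2 hd).trans_le hf),
    fun h => MvPowerSeries.nat_le_order h⟩

theorem orderIdeal_anti {k l : ℕ} (h : k ≤ l) : orderIdeal n l ≤ orderIdeal n k :=
  fun _ hf => (Nat.cast_le (α := ℕ∞).2 h).trans hf

theorem mul_mem_orderIdeal {k l : ℕ} {f g : MvPowerSeries (Fin n) ℂ} (hf : f ∈ orderIdeal n k)
    (hg : g ∈ orderIdeal n l) : f * g ∈ orderIdeal n (k + l) := by
  change ((k + l : ℕ) : ℕ∞) ≤ _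
  push_cast
  exact (add_le_add hf hg).trans MvPowerSeries.le_order_mul

theorem pderiv_mem_orderIdeal {k : ℕ} {f : MvPowerSeries (Fin n) ℂ}
    (hf : f ∈ orderIdeal n (k + 1)) (i : Fin n) : MvPowerSeries.pderiv ℂ i f ∈ orderIdeal n k := by
  rw [mem_orderIdeal_iff] at hf ⊢
  intro d hd
  rw [MvPowerSeries.coeff_pderiv, hf _ (by simpa using hd), zero_mul]

theorem fieldDerivation_mem_orderIdeal {F : FormalVectorField n} {a : ℕ}
    (hF : ∀ i, F i ∈ orderIdeal n (a + 1)) {k : ℕ} {f : MvPowerSeries (Fin n) ℂ}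
    (hf : f ∈ orderIdeal n k) : fieldDerivation F f ∈ orderIdeal n (k + a) := by
  rw [fieldDerivation_apply]
  refine Ideal.sum_mem _ fun i _ => ?_
  cases k with
  | zero => exact Ideal.mul_mem_right _ _ (orderIdeal_anti (by omega) (hF i))
  | succ k =>
    have := mul_mem_orderIdeal (hF i) (pderiv_mem_orderIdeal hf i)
    rwa [show a + 1 + k = k + 1 + a by ring] at this

theorem HasDiagonalLinearPart.mem_orderIdeal_one {F : FormalVectorField n} {lam : Fin n → ℂ}
    (hlin : HasDiagonalLinearPart F lam) (i : Fin n) : F i ∈ orderIdeal n 1 :=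
  mem_orderIdeal_iff.2 fun d hd => by
    rw [(Finsupp.degree_eq_zero_iff d).1 (by omega)]
    exact (hlin i).1

theorem HasDiagonalLinearPart.sub_linearField_mem_orderIdeal {F : FormalVectorField n}
    {lam : Fin n → ℂ} (hlin : HasDiagonalLinearPart F lam) (i : Fin n) :
    (F - linearField lam) i ∈ orderIdeal n 2 := by
  refine mem_orderIdeal_iff.2 fun d hd => ?_
  rw [Pi.sub_apply, map_sub, linearField, MvPowerSeries.coeff_C_mul, MvPowerSeries.coeff_X]
  rcases Nat.lt_succ_iff_lt_or_eq.1 hd with h | h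
  · obtain rfl := (Finsupp.degree_eq_zero_iff d).1 (by omega)
    rw [if_neg (by simp [eq_comm]), mul_zero, sub_zero]
    exact (hlin i).1
  · obtain ⟨j, rfl⟩ := (Finsupp.range_single_one (σ := Fin n)).ge h
    rw [(hlin i).2 j]
    by_cases hij : i = j
    · simp [hij]
    · simp [hij, Finsupp.single_left_inj, Ne.symm hij]

theorem fieldDerivation_sub_mem_orderIdeal {F : FormalVectorField n} {lam : Fin n → ℂ}
    (hlin : HasDiagonalLinearPart F lam) {k : ℕ} {f : MvPowerSeries (Fin n) ℂ}
    (hf : f ∈ orderIdeal n k) :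
    fieldDerivation F f - fieldDerivation (linearField lam) f ∈ orderIdeal n (k + 1) := by
  have := fieldDerivation_mem_orderIdeal hlin.sub_linearField_mem_orderIdeal hf
  simpa only [fieldDerivation_apply, Pi.sub_apply, sub_mul, Finset.sum_sub_distrib] using this

/-! ### The linear part as a limit of polynomials in the vector field -/

theorem exists_polynomial_pow_dvd_sub_C (S : Set ℂ) (hS : S.Finite) (k : ℕ) :
    ∃ p : ℂ[X], ∀ μ ∈ S, (Polynomial.X - Polynomial.C μ) ^ k ∣ p - Polynomial.C μ := by
  have := hS.to_subtype
  obtain ⟨p, hp⟩ := Ideal.exists_forall_sub_mem_ideal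
    (I := fun μ : S => Ideal.span {(Polynomial.X - Polynomial.C (μ : ℂ)) ^ k})
    (fun μ ν h => (Ideal.isCoprime_span_singleton_iff _ _).2
      (Polynomial.pairwise_coprime_X_sub_C Subtype.val_injective h).pow)
    (fun μ => Polynomial.C (μ : ℂ))
  exact ⟨p, fun μ hμ => Ideal.mem_span_singleton.1 (hp ⟨μ, hμ⟩)⟩

theorem aeval_fieldDerivation_mem_orderIdeal {F : FormalVectorField n}
    (hF : ∀ i, F i ∈ orderIdeal n 1) (p : ℂ[X]) {k : ℕ} {f : MvPowerSeries (Fin n) ℂ}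
    (hf : f ∈ orderIdeal n k) :
    aeval (fieldDerivation F).toLinearMap p f ∈ orderIdeal n k := by
  have := Polynomial.aeval_apply_smul_mem_of_le_comap
    (q := (orderIdeal n k).restrictScalars ℂ) hf p (fieldDerivation F).toLinearMap
    (fun g hg => fieldDerivation_mem_orderIdeal (a := 0) hF hg)
  exact this

/-- On the weight space of `μ` the operator `F - μ` is the nonlinear part of `F`, so its
`k`-th power raises the order by `k`. -/
theorem pow_sub_weight_mem_orderIdeal {F : FormalVectorField n} {lam : Fin n → ℂ}
    (hlin : HasDiagonalLinearPart F lam) (hnf : IsNormalForm F lam) {μ : ℂ}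
    {f : MvPowerSeries (Fin n) ℂ} (hf : f ∈ weightSpace lam μ) (k : ℕ) :
    aeval (fieldDerivation F).toLinearMap ((Polynomial.X - Polynomial.C μ) ^ k) f ∈
      weightSpace lam μ ∧
    aeval (fieldDerivation F).toLinearMap ((Polynomial.X - Polynomial.C μ) ^ k) f ∈
      orderIdeal n k := by
  induction k with
  | zero => exact ⟨by simpa using hf, by simp [mem_orderIdeal_iff]⟩
  | succ k ih =>
    set g := aeval (fieldDerivation F).toLinearMap ((Polynomial.X - Polynomial.C μ) ^ k) f
    have hg : aeval (fieldDerivation F).toLinearMap ((Polynomial.X - Polynomial.C μ) ^ (k + 1)) f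
        = fieldDerivation F g - μ • g := by
      rw [pow_succ', map_mul, Module.End.mul_apply]
      simp [g]
    rw [hg]
    refine ⟨Submodule.sub_mem _ (hnf.fieldDerivation_mem_weightSpace ih.1)
      (Submodule.smul_mem _ _ ih.1), ?_⟩
    rw [← fieldDerivation_linearField_of_mem_weightSpace ih.1]
    exact fieldDerivation_sub_mem_orderIdeal hlin ih.2

theorem sub_sum_monomial_mem_orderIdeal (f : MvPowerSeries (Fin n) ℂ) (k : ℕ) :
    f - ∑ d ∈ (Finsupp.finite_of_degree_lt (σ := Fin n) k).toFinset,
      MvPowerSeries.monomial d (coeff d f) ∈ orderIdeal n k := by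
  refine mem_orderIdeal_iff.2 fun d hd => ?_
  simp [MvPowerSeries.coeff_monomial, hd]

/-- Modulo terms of degree at least `k`, the linear part of a vector field in normal form is a
polynomial in the vector field: it is the semisimple part in the Jordan–Chevalley decomposition
of the action on power series modulo degree `k`. -/
theorem exists_aeval_fieldDerivation_sub_mem_orderIdeal {F : FormalVectorField n}
    {lam : Fin n → ℂ} (hlin : HasDiagonalLinearPart F lam) (hnf : IsNormalForm F lam) (k : ℕ) :
    ∃ p : ℂ[X], ∀ f, aeval (fieldDerivation F).toLinearMap p f -
      fieldDerivation (linearField lam) f ∈ orderIdeal n k := by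
  have hfin := Finsupp.finite_of_degree_lt (σ := Fin n) k
  obtain ⟨p, hp⟩ := exists_polynomial_pow_dvd_sub_C _ (hfin.image (monomialWeight lam)) k
  refine ⟨p, fun f => ?_⟩
  set T : Module.End ℂ (MvPowerSeries (Fin n) ℂ) := aeval (fieldDerivation F).toLinearMap p -
    (fieldDerivation (linearField lam)).toLinearMap with hT
  change T f ∈ orderIdeal n k
  -- Both operators preserve the order filtration, so it is enough to treat the finitely many
  -- monomials of degree less than `k`.
  have hrem : ∀ g ∈ orderIdeal n k, T g ∈ orderIdeal n k := fun g hg =>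
    Ideal.sub_mem _ (aeval_fieldDerivation_mem_orderIdeal hlin.mem_orderIdeal_one p hg)
      (mem_orderIdeal_iff.2 fun d hd => (coeff_fieldDerivation_linearField lam g d).trans (by
        rw [mem_orderIdeal_iff.1 hg d hd, mul_zero]))
  have hmon : ∀ d : Fin n →₀ ℕ, d.degree < k → ∀ c, T (MvPowerSeries.monomial d c) ∈
      orderIdeal n k := by
    intro d hd c
    have hm : MvPowerSeries.monomial d c ∈ weightSpace lam (monomialWeight lam d) := by
      intro e he
      rw [MvPowerSeries.coeff_monomial] at he
      rw [(ite_ne_right_iff.1 he).1]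
    obtain ⟨q, hq⟩ := hp _ ⟨d, hd, rfl⟩
    have hp' : p = q * (Polynomial.X - Polynomial.C (monomialWeight lam d)) ^ k +
        Polynomial.C (monomialWeight lam d) := by rw [mul_comm q, ← hq]; ring
    have hTm : T (MvPowerSeries.monomial d c) = aeval (fieldDerivation F).toLinearMap q
        (aeval (fieldDerivation F).toLinearMap
          ((Polynomial.X - Polynomial.C (monomialWeight lam d)) ^ k)
          (MvPowerSeries.monomial d c)) := by
      rw [hT, LinearMap.sub_apply, hp', map_add, map_mul, LinearMap.add_apply,
        Module.End.mul_apply, Polynomial.aeval_C, Module.algebraMap_end_apply,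
        Derivation.coeFn_coe,
        fieldDerivation_linearField_of_mem_weightSpace hm, add_sub_cancel_right]
    rw [hTm]
    exact aeval_fieldDerivation_mem_orderIdeal hlin.mem_orderIdeal_one q
      (pow_sub_weight_mem_orderIdeal hlin hnf hm k).2
  rw [← sub_add_cancel f (∑ d ∈ hfin.toFinset, MvPowerSeries.monomial d (coeff d f)), map_add,
    map_sum]
  exact Ideal.add_mem _ (hrem _ (sub_sum_monomial_mem_orderIdeal f k))
    (Ideal.sum_mem _ fun d hd => hmon d (by simpa using hd) _)

/-! ### First integrals of the linear part -/

/-- If `D (v / w) = 0` then `p(D) v = (v / w) p(D) w` for every polynomial `p`. -/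
theorem mul_aeval_derivation_eq {R : Type*} [CommRing R] [IsDomain R] [Algebra ℂ R]
    (D : Derivation ℂ R R) {v w : R} (hw : w ≠ 0) (h : w * D v = v * D w) (p : ℂ[X]) :
    w * aeval D.toLinearMap p v = v * aeval D.toLinearMap p w := by
  have hstep : ∀ a b : R, w * a = v * b → w * D a = v * D b := by
    intro a b hab
    have hD := congrArg D hab
    simp only [Derivation.leibniz, smul_eq_mul] at hD
    refine mul_left_cancel₀ hw ?_
    linear_combination w * hD + b * h - D w * hab
  have hpow : ∀ j : ℕ, w * (D.toLinearMap ^ j) v = v * (D.toLinearMap ^ j) w := by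
    intro j
    induction j with
    | zero => simp [mul_comm]
    | succ j ih =>
      rw [pow_succ', Module.End.mul_apply, Module.End.mul_apply]
      exact hstep _ _ ih
  induction p using Polynomial.induction_on' with
  | add p q hp hq => simp only [map_add, LinearMap.add_apply, mul_add, hp, hq]
  | monomial j c =>
    simp only [Polynomial.aeval_monomial, Module.End.mul_apply, Module.algebraMap_end_apply,
      mul_smul_comm, hpow]

theorem mul_fieldDerivation_linearField_eq {F : FormalVectorField n} {lam : Fin n → ℂ}
    (hlin : HasDiagonalLinearPart F lam) (hnf : IsNormalForm F lam)
    {v w : MvPowerSeries (Fin n) ℂ} (hw : w ≠ 0)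
    (h : w * fieldDerivation F v = v * fieldDerivation F w) :
    w * fieldDerivation (linearField lam) v = v * fieldDerivation (linearField lam) w := by
  rw [← sub_eq_zero]
  ext d
  obtain ⟨p, hp⟩ := exists_aeval_fieldDerivation_sub_mem_orderIdeal hlin hnf (d.degree + 1)
  refine mem_orderIdeal_iff.1 ?_ d (Nat.lt_succ_self _)
  have := Ideal.sub_mem _ (Ideal.mul_mem_left _ v (hp w)) (Ideal.mul_mem_left _ w (hp v))
  rwa [show v * (aeval (fieldDerivation F).toLinearMap p w - fieldDerivation (linearField lam) w) -
      w * (aeval (fieldDerivation F).toLinearMap p v - fieldDerivation (linearField lam) v) =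
      w * fieldDerivation (linearField lam) v - v * fieldDerivation (linearField lam) w by
    linear_combination -mul_aeval_derivation_eq (fieldDerivation F) hw h p] at this

theorem IsFirstIntegral.linearField {F : FormalVectorField n} {lam : Fin n → ℂ}
    (hlin : HasDiagonalLinearPart F lam) (hnf : IsNormalForm F lam) {f : FormalMeromorphic n}
    (hf : IsFirstIntegral F f) : IsFirstIntegral (linearField lam) f := by
  refine ⟨hf.1, ?_⟩
  have h := hf.2
  obtain ⟨v, w, hw, rfl⟩ := IsFractionRing.div_surjective (A := MvPowerSeries (Fin n) ℂ) f
  have hw0 := nonZeroDivisors.ne_zero hw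
  rw [lieDeriv_div_eq_zero_iff _ _ _ hw0] at h ⊢
  exact mul_fieldDerivation_linearField_eq hlin hnf hw0 h

/-! ### Laurent monomial first integrals -/

/-- The linear field acts diagonally on monomials, so it creates no terms below the leading one;
when `b` has weight zero, the leading term of `w` is annihilated and both sides vanish. -/
theorem coeff_add_mul_fieldDerivation_linearField (lam : Fin n → ℂ)
    {v w : MvPowerSeries (Fin n) ℂ} {a b : Fin n →₀ ℕ} (ha : lexOrder v = toLex a)
    (hb : lexOrder w = toLex b) :
    coeff (a + b) (v * fieldDerivation (linearField lam) w) =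
      coeff a v * (monomialWeight lam b * coeff b w) := by
  rw [← coeff_fieldDerivation_linearField, MvPowerSeries.coeff_mul,
    Finset.sum_eq_single_of_mem ⟨a, b⟩ (by simp)]
  rintro ⟨c, d⟩ hcd hne
  have hsum := Finset.HasAntidiagonal.mem_antidiagonal.1 hcd
  rcases trichotomy_of_add_eq_add (congrArg toLex hsum) with h | h | h
  · exact absurd (Prod.ext h.1 h.2) hne
  · rw [coeff_eq_zero_of_lt_lexOrder (d := c) (by rw [ha]; exact_mod_cast h), zero_mul]
  · rw [coeff_fieldDerivation_linearField,
      coeff_eq_zero_of_lt_lexOrder (d := d) (by rw [hb]; exact_mod_cast h), mul_zero, mul_zero]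

/-- The leading monomials of the numerator and the denominator of a first integral of a linear
vector field have equal weights. -/
theorem monomialWeight_eq_of_lexOrder {lam : Fin n → ℂ} {v w : MvPowerSeries (Fin n) ℂ}
    (h : w * fieldDerivation (linearField lam) v = v * fieldDerivation (linearField lam) w)
    {a b : Fin n →₀ ℕ} (ha : lexOrder v = toLex a) (hb : lexOrder w = toLex b) :
    monomialWeight lam a = monomialWeight lam b := by
  have hv := coeff_ne_zero_of_lexOrder ha.symm
  have hw := coeff_ne_zero_of_lexOrder hb.symm
  have h1 := coeff_add_mul_fieldDerivation_linearField lam hb ha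
  rw [h, add_comm, coeff_add_mul_fieldDerivation_linearField lam ha hb] at h1
  refine mul_left_cancel₀ (mul_ne_zero hv hw) ?_
  linear_combination -h1

/-- A nonconstant quotient `v / w` annihilated by a linear vector field yields two distinct
monomials of equal weight: if `v` and `w` have the same leading monomial, subtracting a constant
multiple of `w` from `v` removes it from `v`. -/
theorem exists_ne_monomialWeight_eq {lam : Fin n → ℂ} {v w : MvPowerSeries (Fin n) ℂ}
    (hw : w ≠ 0) (hne : ∀ c : ℂ, v ≠ c • w)
    (h : w * fieldDerivation (linearField lam) v = v * fieldDerivation (linearField lam) w) :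
    ∃ a b : Fin n →₀ ℕ, a ≠ b ∧ monomialWeight lam a = monomialWeight lam b := by
  obtain ⟨b, hb⟩ := exists_finsupp_eq_lexOrder_of_ne_zero hw
  have hwb := coeff_ne_zero_of_lexOrder hb.symm
  set c : ℂ := coeff b v / coeff b w with hc
  have hu0 : v - c • w ≠ 0 := sub_ne_zero.2 (hne c)
  obtain ⟨a, ha⟩ := exists_finsupp_eq_lexOrder_of_ne_zero hu0
  refine ⟨a, b, ?_, monomialWeight_eq_of_lexOrder ?_ ha hb⟩
  · rintro rfl
    apply coeff_ne_zero_of_lexOrder ha.symm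
    rw [map_sub, MvPowerSeries.coeff_smul, hc, div_mul_cancel₀ _ hwb, sub_self]
  · rw [map_sub, Derivation.map_smul, mul_sub, sub_mul, h, mul_smul_comm, smul_mul_assoc]

theorem laurentMonomial_sub (a b : Fin n →₀ ℕ) :
    laurentMonomial (fun i => (a i : ℤ) - b i) =
      algebraMap _ (FormalMeromorphic n) (MvPowerSeries.monomial a (1 : ℂ)) /
        algebraMap _ (FormalMeromorphic n) (MvPowerSeries.monomial b (1 : ℂ)) := by
  have hX : ∀ i, algebraMap (MvPowerSeries (Fin n) ℂ) (FormalMeromorphic n)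
      (MvPowerSeries.X i) ≠ 0 := fun i =>
    (map_ne_zero_iff _ (IsFractionRing.injective _ _)).2 fun h0 => by
      simpa using congrArg (coeff (single i 1)) h0
  have hmon : ∀ a : Fin n →₀ ℕ, MvPowerSeries.monomial a (1 : ℂ) =
      ∏ i, (MvPowerSeries.X i : MvPowerSeries (Fin n) ℂ) ^ a i := by
    intro a
    rw [MvPowerSeries.monomial_eq', Finsupp.prod_fintype _ _ (by simp)]
    simp
  simp only [laurentMonomial, hmon, map_prod, map_pow, zpow_sub₀ (hX _), zpow_natCast,
    Finset.prod_div_distrib]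

theorem isFirstIntegral_laurentMonomial_sub {lam : Fin n → ℂ} {a b : Fin n →₀ ℕ} (hab : a ≠ b)
    (hw : monomialWeight lam a = monomialWeight lam b) :
    IsFirstIntegral (linearField lam) (laurentMonomial fun i => (a i : ℤ) - b i) := by
  have hinj : Function.Injective (algebraMap (MvPowerSeries (Fin n) ℂ) (FormalMeromorphic n)) :=
    IsFractionRing.injective _ _
  have hb0 : MvPowerSeries.monomial b (1 : ℂ) ≠ 0 := fun h0 => by
    simpa using congrArg (coeff b) h0
  have hD : ∀ d : Fin n →₀ ℕ, fieldDerivation (linearField lam) (MvPowerSeries.monomial d (1 : ℂ)) =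
      monomialWeight lam d • MvPowerSeries.monomial d (1 : ℂ) := fun d =>
    fieldDerivation_linearField_of_mem_weightSpace fun e he => by
      rw [MvPowerSeries.coeff_monomial] at he
      rw [(ite_ne_right_iff.1 he).1]
  rw [laurentMonomial_sub]
  refine ⟨fun c hc => ?_, ?_⟩
  · rw [div_eq_iff ((map_ne_zero_iff _ hinj).2 hb0),
      IsScalarTower.algebraMap_apply ℂ (MvPowerSeries (Fin n) ℂ), ← map_mul,
      ← Algebra.smul_def] at hc
    simpa [MvPowerSeries.coeff_monomial, hab] using congrArg (coeff a) (hinj hc)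
  · rw [lieDeriv_div_eq_zero_iff _ _ _ hb0, hD, hD, hw, mul_smul_comm, mul_smul_comm, mul_comm]

theorem IsFirstIntegral.exists_laurentMonomial {lam : Fin n → ℂ} {f : FormalMeromorphic n}
    (hf : IsFirstIntegral (FormalVF.linearField lam) f) :
    ∃ Q : Fin n → ℤ, IsFirstIntegral (FormalVF.linearField lam) (laurentMonomial Q) := by
  obtain ⟨hconst, h⟩ := hf
  obtain ⟨v, w, hw, rfl⟩ := IsFractionRing.div_surjective (A := MvPowerSeries (Fin n) ℂ) f
  have hw0 := nonZeroDivisors.ne_zero hw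
  have hw' : algebraMap (MvPowerSeries (Fin n) ℂ) (FormalMeromorphic n) w ≠ 0 :=
    (map_ne_zero_iff _ (IsFractionRing.injective _ _)).2 hw0
  rw [lieDeriv_div_eq_zero_iff _ _ _ hw0] at h
  have hne : ∀ c : ℂ, v ≠ c • w := by
    rintro c rfl
    apply hconst c
    rw [div_eq_iff hw', IsScalarTower.algebraMap_apply ℂ (MvPowerSeries (Fin n) ℂ), ← map_mul,
      ← Algebra.smul_def]
  obtain ⟨a, b, hab, hwt⟩ := exists_ne_monomialWeight_eq hw0 hne h
  exact ⟨_, isFirstIntegral_laurentMonomial_sub hab hwt⟩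

end FormalVF

end

theorem mainTheorem7 (n : ℕ) (lam : Fin n → ℂ) (F : FormalVF.FormalVectorField n)
    (hlin : FormalVF.HasDiagonalLinearPart F lam) (hnf : FormalVF.IsNormalForm F lam) :
    (∀ f : FormalVF.FormalMeromorphic n, FormalVF.IsFirstIntegral F f →
      FormalVF.IsFirstIntegral (FormalVF.linearField lam) f) ∧
    ((∃ f : FormalVF.FormalMeromorphic n, FormalVF.IsFirstIntegral F f) →
      ∃ Q : Fin n → ℤ,
        FormalVF.IsFirstIntegral (FormalVF.linearField lam) (FormalVF.laurentMonomial Q)) :=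
  ⟨fun _ hf => hf.linearField hlin hnf, fun ⟨_, hf⟩ =>
    (hf.linearField hlin hnf).exists_laurentMonomial⟩
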